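/- Let $\mathcal L$ be a language extending the language $\{0,1,<,+,-,\cdot\}$ of ordered rings, and let $T$ be a complete o-minimal $\mathcal L$-theory extending the theory of real closed ordered fields. Suppose that $T$ defines an exponential function: in models $\mathcal R$ of $T$ there is a definable (with parameters) isomorphism of ordered groups $\exp\colon(\mathcal R,+)\to(\mathcal R^{>},\cdot)$ that is equal to its own derivative. (Such a function is unique and definable without parameters.) Let $T_{\mathfrak M}$ be the theory, in the language $\mathcal L$ with two new unary predicates $\mathcal O$ and $\mathfrak M$, whose models are the structures $(\mathcal R,\mathcal O,\mathfrak M)$ such that - $\mathcal R\models T$; - $\mathcal O$ is a proper $T$-convex subring of $\mathcal R$, i.e. a convex subring $\mathcal O\neq\mathcal R$ that is closed under all continuous functions $f\colon\mathcal R\to\mathcal R$ that are $\mathcal L$-definable without parameters; - $\mathfrak M$ is a $T$-compatible monomial group, i.e. a subgroup of the multiplicative group $\mathcal R^{>}$ of positive elements which the quotient map $\mathcal R^\times\to\mathcal R^\times/\mathcal O^\times$ maps bijectively onto the value group $\mathcal R^\times/\mathcal O^\times$, and such that $\{\mathfrak m\in\mathfrak M:\mathfrak m>1\}$ is closed under $\exp$.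 Then every completion $T'$ of $T_{\mathfrak M}$ has the antichain tree property: there are a formula $\varphi(x,y)$, where $x$ and $y$ are finite tuples of variables, and a family $(a_\eta)_{\eta\in 2^{<\omega}}$ of tuples of parameters from a model of $T'$, such that for every $I\subseteq 2^{<\omega}$ the set of formulas $\{\varphi(x,a_\eta):\eta\in I\}$ is consistent (that is, realized in an elementary extension of this model) if and only if $I$ is an antichain, i.e. no member of $I$ is a proper initial segment of another. -/

import Mathlib

open FirstOrder FirstOrder.Language

universe u v

/-- The only relation symbol of the language of ordered rings: the binary symbol `<`. -/
inductive OrdRingRel : ℕ → Type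
  | lt : OrdRingRel 2

/-- The language `{0, 1, <, +, -, ·}` of ordered rings (function symbols as in
`FirstOrder.Language.ring`). -/
def orderedRing : FirstOrder.Language.{0, 0} where
  Functions := ringFunc
  Relations := OrdRingRel

section OMinimalTheories

/-- `ι : orderedRing →ᴸ L` presents `L` as a language extending that of ordered rings.
An `L`-structure on an ordered field `R` is compatible if it interprets the symbols of the
language of ordered rings by the ordered field structure of `R`. -/
structure CompatibleOrderedField {L : FirstOrder.Language.{u, v}} (ι : orderedRing →ᴸ L)
    (R : Type*) [L.Structure R] [Field R] [LinearOrder R] : Prop where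
  zero : Structure.funMap (ι.onFunction (.zero : ringFunc 0)) (![] : Fin 0 → R) = 0
  one : Structure.funMap (ι.onFunction (.one : ringFunc 0)) (![] : Fin 0 → R) = 1
  neg : ∀ x : R, Structure.funMap (ι.onFunction (.neg : ringFunc 1)) ![x] = -x
  add : ∀ x y : R, Structure.funMap (ι.onFunction (.add : ringFunc 2)) ![x, y] = x + y
  mul : ∀ x y : R, Structure.funMap (ι.onFunction (.mul : ringFunc 2)) ![x, y] = x * y
  lt : ∀ x y : R, Structure.RelMap (ι.onRelation (OrdRingRel.lt : OrdRingRel 2)) ![x, y] ↔ x < y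

/-- `T` extends the theory of real closed ordered fields: every model of `T` is, with the
operations and the order named by the language, a real closed ordered field. -/
def ExtendsRCF {L : FirstOrder.Language.{u, v}} (ι : orderedRing →ᴸ L) (T : L.Theory) : Prop :=
  ∀ R : T.ModelType.{u, v, max u v}, ∃ (_ : Field R) (_ : LinearOrder R),
    IsStrictOrderedRing R ∧ IsRealClosed R ∧ CompatibleOrderedField ι R

/-- A model of `T` which is an ordered field, together with its ordered field structure.  If `T`
extends the theory of real closed ordered fields, these are just the models of `T`. -/
structure OrderedFieldModel {L : FirstOrder.Language.{u, v}} (ι : orderedRing →ᴸ L) (T : L.Theory) :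
    Type (max u v + 1) where
  Carrier : Type (max u v)
  [struc : L.Structure Carrier]
  [field : Field Carrier]
  [order : LinearOrder Carrier]
  [isStrictOrderedRing : IsStrictOrderedRing Carrier]
  compatible : CompatibleOrderedField ι Carrier
  isModel : Carrier ⊨ T

instance {L : FirstOrder.Language.{u, v}} (ι : orderedRing →ᴸ L) (T : L.Theory) :
    CoeSort (OrderedFieldModel ι T) (Type (max u v)) := ⟨OrderedFieldModel.Carrier⟩

attribute [instance] OrderedFieldModel.struc OrderedFieldModel.field OrderedFieldModel.order
  OrderedFieldModel.isStrictOrderedRing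

/-- Points and open intervals with endpoints in `R ∪ {-∞, +∞}`. -/
inductive IsPointOrInterval {R : Type*} [LinearOrder R] : Set R → Prop
  | point (a : R) : IsPointOrInterval {a}
  | bounded (a b : R) : IsPointOrInterval (Set.Ioo a b)
  | below (b : R) : IsPointOrInterval (Set.Iio b)
  | above (a : R) : IsPointOrInterval (Set.Ioi a)
  | whole : IsPointOrInterval Set.univ

/-- `T` is o-minimal: in every model, each subset of the line definable with parameters is a finite
union of points and open intervals. -/
def IsOMinimal {L : FirstOrder.Language.{u, v}} (ι : orderedRing →ᴸ L) (T : L.Theory) : Prop :=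
  ∀ (R : OrderedFieldModel ι T) (s : Set R), (Set.univ : Set R).Definable₁ L s →
    ∃ C : Set (Set R), C.Finite ∧ (∀ I ∈ C, IsPointOrInterval I) ∧ s = ⋃₀ C

/-- An exponential function on an ordered field `R`: an isomorphism of ordered groups from `(R, +)`
onto the multiplicative group of positive elements, equal to its own derivative. -/
structure IsExponential {R : Type*} [Field R] [LinearOrder R] (f : R → R) : Prop where
  map_add : ∀ x y, f (x + y) = f x * f y
  strictMono : StrictMono f
  range_eq : Set.range f = {y | 0 < y}
  deriv_eq_self : ∀ x, ∀ ε > 0, ∃ δ > 0, ∀ h, h ≠ 0 → |h| < δ →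
    |(f (x + h) - f x) / h - f x| < ε

/-- Continuity of a function on an ordered field, for the order topology. -/
def IsContinuous {R : Type*} [Field R] [LinearOrder R] (f : R → R) : Prop :=
  ∀ x, ∀ ε > 0, ∃ δ > 0, ∀ y, |y - x| < δ → |f y - f x| < ε

/-- `T` defines an exponential function: some model of `T` (equivalently, as `T` will be complete,
every model) has an exponential function that is definable with parameters. -/
def DefinesExponential {L : FirstOrder.Language.{u, v}} (ι : orderedRing →ᴸ L) (T : L.Theory) : Prop :=
  ∃ (R : OrderedFieldModel ι T) (f : R → R), IsExponential f ∧
    (Set.univ : Set R).Definable₂ L {p : R × R | p.2 = f p.1}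

/-- The parameter-free formula `φ(x, y)` defines the graph of `f`. -/
def DefinesGraph {L : FirstOrder.Language.{u, v}} {R : Type*} [L.Structure R]
    (φ : L.Formula (Fin 2)) (f : R → R) : Prop :=
  ∀ x y : R, φ.Realize ![x, y] ↔ y = f x

/-- In the models of `T`, the formula `φ` defines a continuous function of one variable. -/
def DefinesContinuousFunction {L : FirstOrder.Language.{u, v}} (ι : orderedRing →ᴸ L) (T : L.Theory)
    (φ : L.Formula (Fin 2)) : Prop :=
  ∀ R : OrderedFieldModel ι T, ∃ f : R → R, IsContinuous f ∧ DefinesGraph φ f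

/-- In the models of `T`, the formula `φ` defines an exponential function. -/
def DefinesExponentialFunction {L : FirstOrder.Language.{u, v}} (ι : orderedRing →ᴸ L) (T : L.Theory)
    (φ : L.Formula (Fin 2)) : Prop :=
  ∀ R : OrderedFieldModel ι T, ∃ f : R → R, IsExponential f ∧ DefinesGraph φ f

end OMinimalTheories

section TheoryTM

/-- Two unary relation symbols: one for the subring `𝒪`, one for the monomial group `𝔐`. -/
inductive ValRel : ℕ → Type
  | ringO : ValRel 1
  | monM : ValRel 1

/-- The language with just the two unary relation symbols `𝒪` and `𝔐`. -/
def valLang : FirstOrder.Language.{0, 0} where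
  Functions := fun _ => Empty
  Relations := ValRel

/-- The language `L_𝔐 = L ∪ {𝒪, 𝔐}`. -/
abbrev LM (L : FirstOrder.Language.{u, v}) : FirstOrder.Language.{u, v} := L.sum valLang

section Terms

variable {L : FirstOrder.Language.{u, v}} {k : ℕ}

/-- The term `0`. -/
def zeroT (ι : orderedRing →ᴸ L) : L.Term (Empty ⊕ Fin k) :=
  Constants.term (ι.onFunction (.zero : ringFunc 0))

/-- The term `1`. -/
def oneT (ι : orderedRing →ᴸ L) : L.Term (Empty ⊕ Fin k) :=
  Constants.term (ι.onFunction (.one : ringFunc 0))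

/-- The term `-s`. -/
def negT (ι : orderedRing →ᴸ L) (s : L.Term (Empty ⊕ Fin k)) : L.Term (Empty ⊕ Fin k) :=
  Functions.apply₁ (ι.onFunction (.neg : ringFunc 1)) s

/-- The term `s + t`. -/
def addT (ι : orderedRing →ᴸ L) (s t : L.Term (Empty ⊕ Fin k)) : L.Term (Empty ⊕ Fin k) :=
  Functions.apply₂ (ι.onFunction (.add : ringFunc 2)) s t

/-- The term `s * t`. -/
def mulT (ι : orderedRing →ᴸ L) (s t : L.Term (Empty ⊕ Fin k)) : L.Term (Empty ⊕ Fin k) :=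
  Functions.apply₂ (ι.onFunction (.mul : ringFunc 2)) s t

/-- The formula `s < t`. -/
def ltF (ι : orderedRing →ᴸ L) (s t : L.Term (Empty ⊕ Fin k)) : L.BoundedFormula Empty k :=
  Relations.boundedFormula₂ (ι.onRelation (OrdRingRel.lt : OrdRingRel 2)) s t

end Terms

variable {L : FirstOrder.Language.{u, v}} {k : ℕ}

/-- `L_𝔐` extends the language of ordered rings, as `L` does. -/
def extLM (ι : orderedRing →ᴸ L) : orderedRing →ᴸ LM L :=
  (LHom.sumInl : L →ᴸ LM L).comp ι

/-- The relation symbol for `𝒪`. -/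
def symO : (LM L).Relations 1 :=
  (LHom.sumInr : valLang →ᴸ LM L).onRelation (ValRel.ringO : ValRel 1)

/-- The relation symbol for `𝔐`. -/
def symM : (LM L).Relations 1 :=
  (LHom.sumInr : valLang →ᴸ LM L).onRelation (ValRel.monM : ValRel 1)

/-- The formula `t ∈ 𝒪`. -/
def inO (t : (LM L).Term (Empty ⊕ Fin k)) : (LM L).BoundedFormula Empty k :=
  Relations.boundedFormula₁ symO t

/-- The formula `t ∈ 𝔐`. -/
def inM (t : (LM L).Term (Empty ⊕ Fin k)) : (LM L).BoundedFormula Empty k :=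
  Relations.boundedFormula₁ symM t

/-- The `L`-formula `φ(x, y)`, as an `L_𝔐`-formula in the bound variables `&0`, `&1`. -/
def liftF (φ : L.Formula (Fin 2)) : (LM L).BoundedFormula Empty 2 :=
  BoundedFormula.relabel (k := 0) (Sum.inr : Fin 2 → Empty ⊕ Fin 2)
    ((LHom.sumInl : L →ᴸ LM L).onFormula φ)

/-- `𝒪` is a proper convex subring. -/
def properConvexSubringAxioms (κ : orderedRing →ᴸ LM L) : (LM L).Theory :=
  { inO (zeroT κ),
    inO (oneT κ),
    ∀' (inO &0 ⟹ inO (negT κ &0)),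
    ∀' ∀' (inO &0 ⟹ inO &1 ⟹ inO (addT κ &0 &1)),
    ∀' ∀' (inO &0 ⟹ inO &1 ⟹ inO (mulT κ &0 &1)),
    ∀' ∀' ∀' (inO &0 ⟹ inO &2 ⟹ ltF κ &0 &1 ⟹ ltF κ &1 &2 ⟹ inO &1),
    ∃' ∼(inO &0) }

/-- `𝒪` is closed under all continuous functions definable in `L` without parameters. -/
def tConvexAxioms (ι : orderedRing →ᴸ L) (T : L.Theory) : (LM L).Theory :=
  { σ | ∃ φ : L.Formula (Fin 2), DefinesContinuousFunction ι T φ ∧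
      σ = ∀' ∀' (inO &0 ⟹ liftF φ ⟹ inO &1) }

/-- The theory `T_𝒪`: the axioms of `T`, and `𝒪` is a proper `T`-convex subring. -/
def theoryTO (ι : orderedRing →ᴸ L) (T : L.Theory) : (LM L).Theory :=
  (LHom.sumInl : L →ᴸ LM L).onTheory T ∪ properConvexSubringAxioms (extLM ι) ∪ tConvexAxioms ι T

/-- `𝔐` is a monomial group: a multiplicative subgroup of the positive elements which the valuation
maps injectively (`𝔐` meets the units of `𝒪` only in `1`) and surjectively (each nonzero element is
the product of an element of `𝔐` and a unit of `𝒪`) onto the value group. -/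
def monomialGroupAxioms (κ : orderedRing →ᴸ LM L) : (LM L).Theory :=
  { ∀' (inM &0 ⟹ ltF κ (zeroT κ) &0),
    inM (oneT κ),
    ∀' ∀' (inM &0 ⟹ inM &1 ⟹ inM (mulT κ &0 &1)),
    ∀' ∀' (inM &0 ⟹ (mulT κ &0 &1 =' oneT κ) ⟹ inM &1),
    ∀' ∀' (inM &0 ⟹ inO &0 ⟹ inO &1 ⟹ (mulT κ &0 &1 =' oneT κ) ⟹ (&0 =' oneT κ)),
    ∀' (∼(&0 =' zeroT κ) ⟹
      ∃' ∃' ∃' (inM &1 ⊓ inO &2 ⊓ inO &3 ⊓ (mulT κ &2 &3 =' oneT κ) ⊓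
        (&0 =' mulT κ &1 &2))) }

/-- `{m ∈ 𝔐 | m > 1}` is closed under the exponential function that `T` defines. -/
def expCompatibleAxioms (ι : orderedRing →ᴸ L) (T : L.Theory) : (LM L).Theory :=
  { σ | ∃ φ : L.Formula (Fin 2), DefinesExponentialFunction ι T φ ∧
      σ = ∀' ∀' (inM &0 ⟹ ltF (extLM ι) (oneT (extLM ι)) &0 ⟹ liftF φ ⟹
        inM &1 ⊓ ltF (extLM ι) (oneT (extLM ι)) &1) }

/-- The theory `T_𝔐`, for a theory `T` that defines an exponential function: the axioms of `T_𝒪`,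
and `𝔐` is a `T`-compatible monomial group. -/
def theoryTM (ι : orderedRing →ᴸ L) (T : L.Theory) : (LM L).Theory :=
  theoryTO ι T ∪ monomialGroupAxioms (extLM ι) ∪ expCompatibleAxioms ι T

end TheoryTM

section ATP

/-- `T'` is a completion of `T`: a complete theory that implies every sentence of `T`. -/
def IsCompletionOf {L : FirstOrder.Language.{u, v}} (T' T : L.Theory) : Prop :=
  T'.IsComplete ∧ ∀ σ ∈ T, T' ⊨ᵇ σ

/-- The set of formulas `{φ(x, a i) : i ∈ J}` with parameters from `N` is consistent (with the
elementary diagram of `N`): it is realized in some elementary extension of `N`. -/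
def IsConsistentFamily {L : FirstOrder.Language.{u, v}} {m n : ℕ} (φ : L.Formula (Fin m ⊕ Fin n))
    {N : Type (max u v)} [L.Structure N] {J : Type*} (a : J → Fin n → N) : Prop :=
  ∃ (N' : Type (max u v)) (_ : L.Structure N') (j : N ↪ₑ[L] N') (b : Fin m → N'),
    ∀ i : J, φ.Realize (Sum.elim b (fun l => j (a i l)))

/-- The antichain tree property: for some formula `φ(x, y)` (`x`, `y` finite tuples of variables)
and some parameters `a η` indexed by the binary tree of finite `0`-`1`-sequences, ordered by
initial segment, `{φ(x, a η) : η ∈ I}` is consistent exactly when `I` is an antichain. -/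
def HasATP {L : FirstOrder.Language.{u, v}} (T : L.Theory) : Prop :=
  ∃ (m n : ℕ) (φ : L.Formula (Fin m ⊕ Fin n)) (N : T.ModelType.{u, v, max u v})
    (a : List Bool → Fin n → N), ∀ I : Set (List Bool),
      IsConsistentFamily φ (fun η : I => a η) ↔ IsAntichain (fun η ν => η <+: ν) I

end ATP

-- In a model of `T_𝔐`, finite sets of monomials can be coded by their sums. Let `b` be the sum of a
-- finite set `F` of monomials and let `y ∈ 𝔐`. In `b / y`, a summand `m / y > 1` lies in `log 𝔐`,
-- because `exp` maps it into `𝔐`; a summand `m / y < 1` is infinitesimal; and the summand `1`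
-- occurs exactly when `y ∈ F`. Now `log 𝔐` is an additive group meeting `𝒪` only in `0`, since `𝒪`
-- is closed under `exp` and a monomial unit is `1`. Hence `1` is not a difference of elements of
-- `log 𝔐 + infinitesimals`, and `y ∈ F` if and only if `b / y` is not in that set
-- (`inSupport_sum_iff`). So one formula defines all finite subsets of the infinite set of powers of
-- a monomial `m > 1`.
--
-- This yields the antichain tree property (`hasATP_of_forall_finset_definable`): label the nodes
-- injectively, and let `φ(x, a η)` say that the set coded by `x` contains the label of `η` but no
-- label of a proper initial segment of `η`.
--
-- The formula needs `exp` without parameters. O-minimality makes a definable exponential unique,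
-- and completeness of `T` carries its existence to all models
-- (`exists_definesExponentialFunction`).

universe w

/-! ### Building formulas that have one meaning in all models -/

section UniformDefinability

variable {L : FirstOrder.Language.{u, v}} {ι : orderedRing →ᴸ L} {T : L.Theory} {γ : Type w}

/-- A relation between parameters `w` and variables `v`, given in each model of `T`, is uniformly
definable if one formula defines it in all models. -/
def UniformlyDefinable
    (P : ∀ R : OrderedFieldModel ι T, (γ → R) → (ℕ → R) → Prop) : Prop :=
  ∃ φ : L.Formula (γ ⊕ ℕ), ∀ (R : OrderedFieldModel ι T) (w : γ → R) (v : ℕ → R),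
    φ.Realize (Sum.elim w v) ↔ P R w v

/-- A function of parameters and variables which in all models is given by one term. -/
def UniformTerm (t : ∀ R : OrderedFieldModel ι T, (γ → R) → (ℕ → R) → R) : Prop :=
  ∃ s : L.Term (γ ⊕ ℕ), ∀ (R : OrderedFieldModel ι T) (w : γ → R) (v : ℕ → R),
    s.realize (Sum.elim w v) = t R w v

namespace UniformTerm

variable {s t : ∀ R : OrderedFieldModel ι T, (γ → R) → (ℕ → R) → R}

theorem var (k : ℕ) : UniformTerm (fun (_ : OrderedFieldModel ι T) (_ : γ → _) v => v k) :=
  ⟨Term.var (Sum.inr k), fun _ _ _ => rfl⟩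

theorem param (g : γ) : UniformTerm (fun (_ : OrderedFieldModel ι T) w _ => w g) :=
  ⟨Term.var (Sum.inl g), fun _ _ _ => rfl⟩

theorem zero : UniformTerm (fun (R : OrderedFieldModel ι T) (_ : γ → R) _ => (0 : R)) :=
  ⟨Constants.term (ι.onFunction (.zero : ringFunc 0)), fun R _ _ =>
    Term.realize_constants.trans (funMap_eq_coe_constants.symm.trans R.compatible.zero)⟩

theorem one : UniformTerm (fun (R : OrderedFieldModel ι T) (_ : γ → R) _ => (1 : R)) :=
  ⟨Constants.term (ι.onFunction (.one : ringFunc 0)), fun R _ _ =>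
    Term.realize_constants.trans (funMap_eq_coe_constants.symm.trans R.compatible.one)⟩

theorem neg (hs : UniformTerm s) : UniformTerm (fun R w v => - s R w v) := by
  obtain ⟨s', hs⟩ := hs
  exact ⟨Functions.apply₁ (ι.onFunction (.neg : ringFunc 1)) s', fun R w v => by
    rw [Term.realize_functions_apply₁, hs, R.compatible.neg]⟩

theorem add (hs : UniformTerm s) (ht : UniformTerm t) :
    UniformTerm (fun R w v => s R w v + t R w v) := by
  obtain ⟨s', hs⟩ := hs
  obtain ⟨t', ht⟩ := ht
  exact ⟨Functions.apply₂ (ι.onFunction (.add : ringFunc 2)) s' t', fun R w v => by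
    rw [Term.realize_functions_apply₂, hs, ht, R.compatible.add]⟩

theorem mul (hs : UniformTerm s) (ht : UniformTerm t) :
    UniformTerm (fun R w v => s R w v * t R w v) := by
  obtain ⟨s', hs⟩ := hs
  obtain ⟨t', ht⟩ := ht
  exact ⟨Functions.apply₂ (ι.onFunction (.mul : ringFunc 2)) s' t', fun R w v => by
    rw [Term.realize_functions_apply₂, hs, ht, R.compatible.mul]⟩

theorem sub (hs : UniformTerm s) (ht : UniformTerm t) :
    UniformTerm (fun R w v => s R w v - t R w v) := by
  simpa only [sub_eq_add_neg] using hs.add ht.neg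

end UniformTerm

namespace UniformlyDefinable

variable {s t : ∀ R : OrderedFieldModel ι T, (γ → R) → (ℕ → R) → R}
  {P Q : ∀ R : OrderedFieldModel ι T, (γ → R) → (ℕ → R) → Prop}

theorem formula {δ : Type*} (φ : L.Formula δ)
    {s : δ → ∀ R : OrderedFieldModel ι T, (γ → R) → (ℕ → R) → R} (hs : ∀ d, UniformTerm (s d)) :
    UniformlyDefinable (fun (R : OrderedFieldModel ι T) (w : γ → R) v =>
      φ.Realize (fun d => s d R w v)) := by
  choose s' hs using hs
  refine ⟨BoundedFormula.subst φ s', fun R w v => ?_⟩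
  refine BoundedFormula.realize_subst.trans ?_
  simp only [hs]
  rfl

theorem formula₂ (φ : L.Formula (Fin 2)) (hs : UniformTerm s) (ht : UniformTerm t) :
    UniformlyDefinable (fun R w v => φ.Realize ![s R w v, t R w v]) := by
  have := formula (γ := γ) (ι := ι) (T := T) φ (s := ![s, t])
    (fun d => by fin_cases d <;> assumption)
  convert! this using 4 with R w v
  refine iff_of_eq (congrArg (Formula.Realize (M := R) φ) (funext fun d => ?_))
  fin_cases d <;> rfl

theorem formula₂_params {γ' : Type*} (ψ : L.Formula (γ' ⊕ Fin 2)) (i : γ' → γ)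
    (hs : UniformTerm s) (ht : UniformTerm t) :
    UniformlyDefinable (fun R w v => ψ.Realize (Sum.elim (fun c => w (i c)) ![s R w v, t R w v])) := by
  have := formula (γ := γ) (ι := ι) (T := T) ψ
    (s := Sum.elim (fun c R w _ => w (i c)) ![s, t])
    (fun d => by
      rcases d with c | d
      · exact .param (i c)
      · fin_cases d <;> assumption)
  convert! this using 4 with R w v
  refine iff_of_eq (congrArg (Formula.Realize (M := R) ψ) (funext fun d => ?_))
  rcases d with c | d
  · rfl
  · fin_cases d <;> rfl

theorem rel₁ (r : L.Relations 1) (hs : UniformTerm s) :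
    UniformlyDefinable (fun R w v => Structure.RelMap r ![s R w v]) := by
  obtain ⟨s', hs⟩ := hs
  exact ⟨r.formula₁ s', fun R w v => by rw [Formula.realize_rel₁, hs]⟩

theorem lt (hs : UniformTerm s) (ht : UniformTerm t) :
    UniformlyDefinable (fun R w v => s R w v < t R w v) := by
  obtain ⟨s', hs⟩ := hs
  obtain ⟨t', ht⟩ := ht
  exact ⟨Relations.formula₂ (ι.onRelation (OrdRingRel.lt : OrdRingRel 2)) s' t', fun R w v => by
    rw [Formula.realize_rel₂, hs, ht, R.compatible.lt]⟩

theorem eq (hs : UniformTerm s) (ht : UniformTerm t) :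
    UniformlyDefinable (fun R w v => s R w v = t R w v) := by
  obtain ⟨s', hs⟩ := hs
  obtain ⟨t', ht⟩ := ht
  exact ⟨Term.equal s' t', fun R w v => by rw [Formula.realize_equal, hs, ht]⟩

theorem and (hP : UniformlyDefinable P) (hQ : UniformlyDefinable Q) :
    UniformlyDefinable (fun R w v => P R w v ∧ Q R w v) := by
  obtain ⟨φ, hφ⟩ := hP
  obtain ⟨ψ, hψ⟩ := hQ
  exact ⟨φ ⊓ ψ, fun R w v => by rw [Formula.realize_inf, hφ, hψ]⟩

theorem not (hP : UniformlyDefinable P) : UniformlyDefinable (fun R w v => ¬ P R w v) := by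
  obtain ⟨φ, hφ⟩ := hP
  exact ⟨∼φ, fun R w v => by rw [Formula.realize_not, hφ]⟩

theorem imp (hP : UniformlyDefinable P) (hQ : UniformlyDefinable Q) :
    UniformlyDefinable (fun R w v => P R w v → Q R w v) := by
  obtain ⟨φ, hφ⟩ := hP
  obtain ⟨ψ, hψ⟩ := hQ
  exact ⟨φ.imp ψ, fun R w v => by rw [Formula.realize_imp, hφ, hψ]⟩

theorem iff (hP : UniformlyDefinable P) (hQ : UniformlyDefinable Q) :
    UniformlyDefinable (fun R w v => P R w v ↔ Q R w v) := by
  simpa only [iff_iff_implies_and_implies] using (hP.imp hQ).and (hQ.imp hP)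

/-- Quantification over the variable with index `0`. -/
theorem ex {P : ∀ R : OrderedFieldModel ι T, (γ → R) → (ℕ → R) → R → Prop}
    (hP : UniformlyDefinable (fun R w v => P R w (fun k => v (k + 1)) (v 0))) :
    UniformlyDefinable (fun R w v => ∃ x, P R w v x) := by
  obtain ⟨φ, hφ⟩ := hP
  -- Variable `0` becomes the quantified one and the others shift down by one, as for de Bruijn
  -- indices.
  let g : γ ⊕ ℕ → (γ ⊕ ℕ) ⊕ Unit :=
    Sum.elim (fun c => Sum.inl (Sum.inl c))
      (fun k => Nat.casesOn k (Sum.inr ()) fun k => Sum.inl (Sum.inr k))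
  refine ⟨Formula.iExs Unit (φ.relabel g), fun R w v => ?_⟩
  have key : ∀ z : Unit → R, (φ.relabel g).Realize (Sum.elim (Sum.elim w v) z) ↔
      P R w v (z ()) := by
    intro z
    have := hφ R w (fun k => Nat.casesOn k (z ()) v)
    rw [Formula.realize_relabel]
    refine Iff.trans ?_ this
    refine iff_of_eq (congrArg _ ?_)
    funext s
    rcases s with c | k
    · rfl
    · cases k <;> rfl
  simp only [Formula.realize_iExs, key]
  exact ⟨fun ⟨z, hz⟩ => ⟨z (), hz⟩, fun ⟨z, hz⟩ => ⟨fun _ => z, hz⟩⟩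

theorem all {P : ∀ R : OrderedFieldModel ι T, (γ → R) → (ℕ → R) → R → Prop}
    (hP : UniformlyDefinable (fun R w v => P R w (fun k => v (k + 1)) (v 0))) :
    UniformlyDefinable (fun R w v => ∀ x, P R w v x) := by
  have := (ex (P := fun R w v x => ¬ P R w v x) hP.not).not
  simpa only [not_exists, not_not] using this

/-- The bridge to o-minimality: parameters and remaining variables become constants from `R`. -/
theorem definable₁ {P : ∀ R : OrderedFieldModel ι T, (γ → R) → (ℕ → R) → R → Prop}
    (hP : UniformlyDefinable (fun R w v => P R w (fun k => v (k + 1)) (v 0)))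
    (R : OrderedFieldModel ι T) (w : γ → R) (v : ℕ → R) :
    (Set.univ : Set R).Definable₁ L {x | P R w v x} := by
  obtain ⟨φ, hφ⟩ := hP
  rw [Set.Definable₁, Set.definable_iff_exists_formula_sum]
  let g : γ ⊕ ℕ → (Set.univ : Set R) ⊕ Fin 1 :=
    Sum.elim (fun c => Sum.inl ⟨w c, trivial⟩)
      (fun k => Nat.casesOn k (Sum.inr 0) fun k => Sum.inl ⟨v k, trivial⟩)
  refine ⟨φ.relabel g, ?_⟩
  ext x
  have := hφ R w (fun k => Nat.casesOn k (x 0) v)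
  simp only [Set.mem_ofPred_eq, Formula.realize_relabel]
  refine this.symm.trans ?_
  refine iff_of_eq (congrArg _ ?_)
  funext s
  rcases s with c | k
  · rfl
  · cases k <;> rfl

end UniformlyDefinable

/-- Existential quantification over a possibly infinite tuple of variables. -/
theorem exists_formula_realize_iff_exists {γ β : Type*} (χ : L.Formula (γ ⊕ β)) :
    ∃ χ' : L.Formula β, ∀ (R : Type*) [L.Structure R] [Nonempty R] (v : β → R),
      χ'.Realize v ↔ ∃ w : γ → R, χ.Realize (Sum.elim w v) := by
  classical
  -- Only the finitely many free variables of `χ` matter, so these alone are quantified; the other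
  -- entries of `w` get an arbitrary value.
  let S := χ.freeVarFinset
  let f : S → β ⊕ S := fun x => Sum.elim (fun _ => Sum.inr x) Sum.inl x.1
  refine ⟨Formula.iExs S (BoundedFormula.restrictFreeVar χ f), fun R _ _ v => ?_⟩
  rw [Formula.realize_iExs]
  constructor
  · rintro ⟨i, hi⟩
    refine ⟨fun c => if h : Sum.inl c ∈ S then i ⟨Sum.inl c, h⟩ else Classical.arbitrary R, ?_⟩
    refine (BoundedFormula.realize_restrictFreeVar _ ?_).1 hi
    rintro ⟨c | b, h⟩
    · have hS : Sum.inl c ∈ S := h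
      simp only [f, Sum.elim_inl, Sum.elim_inr, dif_pos hS]
    · rfl
  · rintro ⟨w, hw⟩
    refine ⟨fun x => Sum.elim w v x.1, ?_⟩
    refine (BoundedFormula.realize_restrictFreeVar _ ?_).2 hw
    rintro ⟨c | b, h⟩ <;> rfl

end UniformDefinability

/-! ### From coded finite sets to the antichain tree property -/

section AntichainTree

variable {L : FirstOrder.Language.{u, v}}

/-- A family of formulas over `N` is consistent if all its finite subfamilies are realized in `N`;
the elementary extension is an ultrapower. -/
theorem isConsistentFamily_of_finite {m n : ℕ} {φ : L.Formula (Fin m ⊕ Fin n)}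
    {N : Type (max u v)} [L.Structure N] [Nonempty N] {J : Type} {a : J → Fin n → N}
    (h : ∀ F : Finset J, ∃ b : Fin m → N, ∀ i ∈ F, φ.Realize (Sum.elim b (a i))) :
    IsConsistentFamily φ a := by
  classical
  choose b hb using h
  -- An ultrafilter finer than `atTop` contains, for each `i`, the collection of all finite sets
  -- having `i` as a member.
  let U : Ultrafilter (Finset J) := Ultrafilter.of Filter.atTop
  let c (x : N) : (U : Filter (Finset J)).Product (fun _ => N) :=
    ((fun _ => x : Finset J → N) : (U : Filter (Finset J)).Product (fun _ => N))
  refine ⟨(U : Filter (Finset J)).Product (fun _ => N), inferInstance, ⟨c, ?_⟩,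
    fun k => ((fun F => b F k : Finset J → N) : (U : Filter (Finset J)).Product (fun _ => N)), ?_⟩
  · intro k ψ x
    have := Ultraproduct.realize_formula_cast (u := U) (M := fun _ => N) ψ (fun i _ => x i)
    refine this.trans ?_
    simp
  · intro i
    have := Ultraproduct.realize_formula_cast (u := U) (M := fun _ => N) φ
      (Sum.elim (fun k F => b F k) (fun l _ => a i l))
    have hi : ∀ᶠ F in (U : Filter (Finset J)), φ.Realize (Sum.elim (b F) (a i)) := by
      refine Ultrafilter.of_le Filter.atTop ?_
      filter_upwards [Filter.eventually_ge_atTop {i}] with F hF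
      exact hb F i (hF (Finset.mem_singleton_self i))
    have key := this.2 (by
      filter_upwards [hi] with F hF
      convert hF using 1
      funext s
      cases s <;> rfl)
    exact cast (congrArg φ.Realize (funext fun s => by cases s <;> rfl)) key

/-- If a formula uniformly defines all finite subsets of an infinite set, then the theory has the
antichain tree property. -/
theorem hasATP_of_forall_finset_definable {T : L.Theory} (N : T.ModelType.{u, v, max u v})
    (σ : L.Formula (Fin 2)) (e : List Bool → N) (he : Function.Injective e)
    (h : ∀ F : Finset (List Bool), ∃ b : N, ∀ y : N, σ.Realize ![y, b] ↔ ∃ i ∈ F, y = e i) :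
    HasATP T := by
  classical
  choose b hb using h
  -- The set coded by `x` contains the first parameter and is disjoint from the set coded by the
  -- second.
  let φ : L.Formula (Fin 1 ⊕ Fin 2) :=
    σ.relabel ![Sum.inr 0, Sum.inl 0] ⊓
      ∼(Formula.iExs Unit (σ.relabel ![Sum.inr (), Sum.inl (Sum.inl 0)] ⊓
        σ.relabel ![Sum.inr (), Sum.inl (Sum.inr 1)]))
  have hφ : ∀ (N' : Type (max u v)) [L.Structure N'] (x : Fin 1 → N') (p : Fin 2 → N'),
      φ.Realize (Sum.elim x p) ↔ σ.Realize ![p 0, x 0] ∧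
        ¬ ∃ z : N', σ.Realize ![z, x 0] ∧ σ.Realize ![z, p 1] := by
    intro N' _ x p
    have e1 : Sum.elim x p ∘ ![Sum.inr 0, Sum.inl 0] = ![p 0, x 0] := by
      funext i; fin_cases i <;> rfl
    have e2 : ∀ z : Unit → N', Sum.elim (Sum.elim x p) z ∘ ![Sum.inr (), Sum.inl (Sum.inl 0)] =
        ![z (), x 0] := by
      intro z; funext i; fin_cases i <;> rfl
    have e3 : ∀ z : Unit → N', Sum.elim (Sum.elim x p) z ∘ ![Sum.inr (), Sum.inl (Sum.inr 1)] =
        ![z (), p 1] := by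
      intro z; funext i; fin_cases i <;> rfl
    simp only [φ, Formula.realize_inf, Formula.realize_not, Formula.realize_iExs,
      Formula.realize_relabel, e1, e2, e3]
    refine and_congr_right fun _ => not_congr ⟨?_, ?_⟩
    · rintro ⟨z, hz⟩; exact ⟨z (), hz⟩
    · rintro ⟨z, hz⟩; exact ⟨fun _ => z, hz⟩
  let pre (η : List Bool) : Finset (List Bool) := η.inits.toFinset.erase η
  have hpre : ∀ η ν, ν ∈ pre η ↔ ν ≠ η ∧ ν <+: η := by
    intro η ν; simp [pre]
  refine ⟨1, 2, φ, N, fun η => ![e η, b (pre η)], fun I => ⟨?_, ?_⟩⟩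
  · rintro ⟨N', _, j, x, hx⟩ ν hν η hη hne hle
    -- If `ν` is a proper initial segment of `η`, the label of `ν` must belong to the set coded by
    -- `x` and is forbidden by the condition at `η`.
    have h1 := ((hφ _ _ _).1 (hx ⟨ν, hν⟩)).1
    refine ((hφ _ _ _).1 (hx ⟨η, hη⟩)).2 ⟨j (e ν), h1, ?_⟩
    have h2 : σ.Realize ![e ν, b (pre η)] :=
      (hb _ _).2 ⟨ν, (hpre _ _).2 ⟨hne, hle⟩, rfl⟩
    rw [← j.map_formula] at h2
    convert h2 using 1
    funext i; fin_cases i <;> rfl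
  · intro hI
    -- A finite part of an antichain is realized by the code of its own set of labels.
    refine isConsistentFamily_of_finite fun F => ⟨fun _ => b (F.image Subtype.val), fun i hi => ?_⟩
    rw [hφ]
    refine ⟨(hb _ _).2 ⟨i, Finset.mem_image_of_mem _ hi, rfl⟩, ?_⟩
    rintro ⟨z, hz1, hz2⟩
    obtain ⟨k, hk, rfl⟩ := (hb _ _).1 hz1
    obtain ⟨l, hl, hkl⟩ := (hb _ _).1 hz2
    obtain rfl := he hkl
    obtain ⟨k', -, rfl⟩ := Finset.mem_image.1 hk
    rw [hpre] at hl
    exact hI k'.2 i.2 hl.1 hl.2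

end AntichainTree

/-! ### Intervals and exponential functions in ordered fields -/

section OrderedFields

variable {R : Type*} [Field R] [LinearOrder R] [IsStrictOrderedRing R]

/-- A finite union of points and open intervals. -/
def IsFiniteUnionOfIntervals (s : Set R) : Prop :=
  ∃ C : Set (Set R), C.Finite ∧ (∀ I ∈ C, IsPointOrInterval I) ∧ s = ⋃₀ C

/-- The empty case cannot be dropped: `Ioo a b` is allowed with `b ≤ a`. -/
theorem IsPointOrInterval.eq_empty_or_exists_isLUB {I : Set R} (hI : IsPointOrInterval I)
    (hb : BddAbove I) : I = ∅ ∨ ∃ a, IsLUB I a := by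
  cases hI with
  | point a => exact Or.inr ⟨a, isLUB_singleton⟩
  | bounded a b =>
    rcases lt_or_ge a b with h | h
    · exact Or.inr ⟨b, isLUB_Ioo h⟩
    · exact Or.inl (Set.Ioo_eq_empty_of_le h)
  | below b => exact Or.inr ⟨b, isLUB_Iio⟩
  | above a => exact absurd hb (not_bddAbove_Ioi a)
  | whole => exact absurd hb not_bddAbove_univ

theorem IsFiniteUnionOfIntervals.exists_isLUB {s : Set R} (hs : IsFiniteUnionOfIntervals s)
    (hne : s.Nonempty) (hb : BddAbove s) : ∃ a, IsLUB s a := by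
  obtain ⟨C, hC, hI, rfl⟩ := hs
  suffices h : ⋃₀ C = ∅ ∨ ∃ a, IsLUB (⋃₀ C) a from h.resolve_left hne.ne_empty
  clear hne
  induction C, hC using Set.Finite.induction_on with
  | empty => simp
  | @insert I C _ _ ih =>
    rw [Set.sUnion_insert] at hb ⊢
    have h1 := (hI I (Set.mem_insert _ _)).eq_empty_or_exists_isLUB
      (hb.mono Set.subset_union_left)
    have h2 := ih (fun J hJ => hI J (Set.mem_insert_of_mem _ hJ)) (hb.mono Set.subset_union_right)
    rcases h1 with h1 | ⟨a, ha⟩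
    · rwa [h1, Set.empty_union]
    · rcases h2 with h2 | ⟨b, hb⟩
      · rw [h2, Set.union_empty]; exact Or.inr ⟨a, ha⟩
      · exact Or.inr ⟨a ⊔ b, ha.union hb⟩

theorem IsPointOrInterval.exists_Ioo_subset {I : Set R} (hI : IsPointOrInterval I)
    (hinf : I.Infinite) : ∃ p q, p < q ∧ Set.Ioo p q ⊆ I := by
  cases hI with
  | point a => exact absurd (Set.finite_singleton a) hinf
  | bounded a b =>
    rcases lt_or_ge a b with h | h
    · exact ⟨a, b, h, subset_rfl⟩
    · exact absurd (Set.Ioo_eq_empty_of_le h ▸ Set.finite_empty) hinf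
  | below b => exact ⟨b - 1, b, by linarith, fun x hx => hx.2⟩
  | above a => exact ⟨a, a + 1, by linarith, fun x hx => hx.1⟩
  | whole => exact ⟨0, 1, one_pos, Set.subset_univ _⟩

theorem IsFiniteUnionOfIntervals.exists_Ioo_subset {s : Set R} (hs : IsFiniteUnionOfIntervals s)
    (hinf : s.Infinite) : ∃ p q, p < q ∧ Set.Ioo p q ⊆ s := by
  obtain ⟨C, hC, hI, rfl⟩ := hs
  have : ∃ I ∈ C, I.Infinite := by
    by_contra! h
    exact hinf (hC.sUnion h)
  obtain ⟨I, hIC, hIinf⟩ := this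
  obtain ⟨p, q, hpq, h⟩ := (hI I hIC).exists_Ioo_subset hIinf
  exact ⟨p, q, hpq, h.trans (Set.subset_sUnion_of_mem hIC)⟩

/-- In an o-minimal structure, a definable additive subgroup which contains `1` is everything. -/
theorem AddSubgroup.eq_top_of_isFiniteUnionOfIntervals (K : AddSubgroup R) (h1 : (1 : R) ∈ K)
    (hK : IsFiniteUnionOfIntervals (K : Set R))
    (hS : IsFiniteUnionOfIntervals {t : R | 0 < t ∧ ∀ x, 0 < x → x < t → x ∈ K}) : K = ⊤ := by
  have hinf : (K : Set R).Infinite := by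
    refine (Set.infinite_range_of_injective (Nat.cast_injective (R := R))).mono ?_
    rintro _ ⟨n, rfl⟩
    simpa using K.nsmul_mem h1 n
  obtain ⟨p, q, hpq, hIoo⟩ := hK.exists_Ioo_subset hinf
  have hne : {t : R | 0 < t ∧ ∀ x, 0 < x → x < t → x ∈ K}.Nonempty := by
    refine ⟨(q - p) / 2, by linarith, fun x hx hxt => ?_⟩
    -- Every small `x > 0` is a difference of two points of `Ioo p q`: the midpoint and its
    -- translate by `x`.
    have ha : (p + q) / 2 ∈ K := hIoo ⟨by linarith, by linarith⟩
    have hb : (p + q) / 2 + x ∈ K := hIoo ⟨by linarith, by linarith⟩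
    simpa using K.sub_mem hb ha
  have hdouble : ∀ t ∈ {t : R | 0 < t ∧ ∀ x, 0 < x → x < t → x ∈ K},
      2 * t ∈ {t : R | 0 < t ∧ ∀ x, 0 < x → x < t → x ∈ K} := by
    rintro t ⟨ht, h⟩
    refine ⟨by linarith, fun x hx hxt => ?_⟩
    have := h (x / 2) (by linarith) (by linarith)
    simpa using K.add_mem this this
  have hunb : ¬ BddAbove {t : R | 0 < t ∧ ∀ x, 0 < x → x < t → x ∈ K} := by
    intro hb
    obtain ⟨a, ha⟩ := hS.exists_isLUB hne hb
    obtain ⟨t₀, ht₀⟩ := hne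
    have hapos : 0 < a := ht₀.1.trans_le (ha.1 ht₀)
    obtain ⟨t, ht, hlt, -⟩ := ha.exists_between (show a / 2 < a by linarith)
    have := ha.1 (hdouble t ht)
    linarith
  have hpos : ∀ x, 0 < x → x ∈ K := by
    intro x hx
    obtain ⟨t, ht, hxt⟩ := not_bddAbove_iff.1 hunb x
    exact ht.2 x hx hxt
  refine (AddSubgroup.eq_top_iff' K).2 fun x => ?_
  rcases lt_trichotomy x 0 with h | h | h
  · simpa using K.neg_mem (hpos (-x) (by linarith))
  · exact h ▸ K.zero_mem
  · exact hpos x h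

namespace IsExponential

variable {f g : R → R}

theorem pos (hf : IsExponential f) (x : R) : 0 < f x := by
  have : f x ∈ Set.range f := ⟨x, rfl⟩
  rwa [hf.range_eq] at this

theorem map_zero (hf : IsExponential f) : f 0 = 1 := by
  have := hf.map_add 0 0
  rw [add_zero] at this
  exact (mul_eq_left₀ (hf.pos 0).ne').1 this.symm

theorem exists_eq (hf : IsExponential f) {y : R} (hy : 0 < y) : ∃ x, f x = y := by
  have : y ∈ Set.range f := by rwa [hf.range_eq]
  exact this

theorem map_neg (hf : IsExponential f) (x : R) : f (-x) = (f x)⁻¹ := by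
  have := hf.map_add (-x) x
  rw [neg_add_cancel, hf.map_zero] at this
  exact eq_inv_of_mul_eq_one_left this.symm

/-- Continuity puts `exp` among the functions under which a `T`-convex subring is closed. It follows
from monotonicity and surjectivity onto the positive elements. -/
theorem isContinuous (hf : IsExponential f) : IsContinuous f := by
  intro x ε hε
  have hx := hf.pos x
  -- The maximum with `f x / 2` keeps the lower target positive, hence in the range of `f`.
  obtain ⟨a, ha⟩ := hf.exists_eq (y := max (f x / 2) (f x - ε)) (by
    exact lt_max_of_lt_left (by linarith))
  obtain ⟨b, hb⟩ := hf.exists_eq (y := f x + ε) (by linarith)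
  have hax : a < x := hf.strictMono.lt_iff_lt.1 (by
    rw [ha]; exact max_lt (by linarith) (by linarith))
  have hxb : x < b := hf.strictMono.lt_iff_lt.1 (by rw [hb]; linarith)
  refine ⟨min (x - a) (b - x), lt_min (by linarith) (by linarith), fun y hy => ?_⟩
  obtain ⟨h1, h2⟩ := lt_min_iff.1 hy
  have h3 := (abs_lt.1 h1).1
  have h4 := (abs_lt.1 h2).2
  have h5 : f a < f y := hf.strictMono (by linarith)
  have h6 : f y < f b := hf.strictMono (by linarith)
  have h7 : f x - ε ≤ f a := ha ▸ le_max_right _ _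
  rw [abs_lt]
  constructor <;> linarith

/-- Both functions have derivative `1` at `0`, while the chain rule gives `g (s * x)` the derivative
`s` there. -/
theorem eq_one_of_scaling (hf : IsExponential f) (hg : IsExponential g) {s : R}
    (h : ∀ x, f x = g (s * x)) : s = 1 := by
  by_contra hs
  have hs0 : s ≠ 0 := by
    rintro rfl
    have := hf.strictMono one_pos
    rw [h, h] at this
    simp at this
  have hs1 : 0 < |s - 1| := abs_pos.2 (sub_ne_zero.2 hs)
  have hsp : 0 < |s| := abs_pos.2 hs0
  -- With this tolerance `c`, the two errors `c` and `c * |s|` add up to `|s - 1| / 2`.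
  obtain ⟨δ, hδ, hδf⟩ := hf.deriv_eq_self 0 (|s - 1| / (2 * (1 + |s|))) (by positivity)
  obtain ⟨δ', hδ', hδg⟩ := hg.deriv_eq_self 0 (|s - 1| / (2 * (1 + |s|))) (by positivity)
  have hm : 0 < min δ (δ' / |s|) := lt_min hδ (by positivity)
  set k := min δ (δ' / |s|) / 2 with hk
  have hk0 : 0 < k := by positivity
  have hk1 : k < δ := by have := min_le_left δ (δ' / |s|); linarith
  have hk2 : |s * k| < δ' := by
    have : k < δ' / |s| := by have := min_le_right δ (δ' / |s|); linarith
    rw [abs_mul, abs_of_pos hk0, mul_comm]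
    exact (lt_div_iff₀ hsp).1 this
  have e1 := hδf k hk0.ne' (by rwa [abs_of_pos hk0])
  have e2 := hδg (s * k) (mul_ne_zero hs0 hk0.ne') hk2
  rw [zero_add, hf.map_zero, h] at e1
  rw [zero_add, hg.map_zero] at e2
  set r := (g (s * k) - 1) / k
  have e3 : (g (s * k) - 1) / (s * k) - 1 = (r - s) / s := by
    simp only [r]; field_simp
  rw [e3, abs_div, div_lt_iff₀ hsp] at e2
  have e4 : |s - 1| ≤ |r - 1| + |r - s| := by
    rw [abs_sub_comm r s, add_comm]
    simpa using abs_add_le (s - r) (r - 1)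
  have e5 : |s - 1| / (2 * (1 + |s|)) + |s - 1| / (2 * (1 + |s|)) * |s| = |s - 1| / 2 := by
    field_simp
  linarith

end IsExponential

/-- The relation `Q` is the graph of an exponential function; of the derivative, only the value at
`0` needs to be mentioned. -/
def IsExponentialRel (Q : R → R → Prop) : Prop :=
  (∀ x, ∃ y, Q x y) ∧ (∀ x y z, Q x y → Q x z → y = z) ∧
  (∀ x x' y y', Q x y → Q x' y' → Q (x + x') (y * y')) ∧
  (∀ x x' y y', x < x' → Q x y → Q x' y' → y < y') ∧
  (∀ y, 0 < y ↔ ∃ x, Q x y) ∧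
  (∀ ε, 0 < ε → ∃ δ, 0 < δ ∧ ∀ h y, ¬ h = 0 → h * h < δ * δ → Q h y →
    (y - 1 - h) * (y - 1 - h) < (ε * h) * (ε * h))

/-- The difference quotient at `x` is `f x` times the one at `0`, so the derivative at `0` suffices.
Clearing denominators and squaring replaces quotients and absolute values by ring terms. -/
theorem isExponentialRel_iff {Q : R → R → Prop} :
    IsExponentialRel Q ↔ ∃ f : R → R, IsExponential f ∧ ∀ x y, Q x y ↔ y = f x := by
  have key : ∀ ε h y : R, 0 < ε → h ≠ 0 →
      (|(y - 1) / h - 1| < ε ↔ (y - 1 - h) * (y - 1 - h) < (ε * h) * (ε * h)) := by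
    intro ε h y hε hh
    rw [← abs_lt_iff_mul_self_lt, abs_mul, abs_of_pos hε, ← div_lt_iff₀ (abs_pos.2 hh),
      ← abs_div, sub_div (y - 1), div_self hh]
  constructor
  · rintro ⟨h1, h2, h3, h4, h5, h6⟩
    choose f hf using h1
    have hQ : ∀ x y, Q x y ↔ y = f x := fun x y => ⟨fun h => h2 x _ _ h (hf x), fun h => h ▸ hf x⟩
    simp only [hQ] at h3 h4 h5 h6
    have hadd : ∀ x y, f (x + y) = f x * f y := fun x y => (h3 x y _ _ rfl rfl).symm
    have hpos : ∀ x, 0 < f x := fun x => (h5 _).2 ⟨x, rfl⟩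
    refine ⟨f, ⟨hadd, fun x y hxy => h4 x y _ _ hxy rfl rfl, ?_, ?_⟩, hQ⟩
    · ext y
      exact ⟨fun ⟨x, hx⟩ => (h5 y).2 ⟨x, hx.symm⟩, fun h => ((h5 y).1 h).imp fun _ => Eq.symm⟩
    · intro x ε hε
      obtain ⟨δ, hδ, h⟩ := h6 (ε / f x) (div_pos hε (hpos x))
      refine ⟨δ, hδ, fun t ht htδ => ?_⟩
      have := (key _ _ _ (div_pos hε (hpos x)) ht).2 (h t _ ht (by
        rw [← abs_lt_iff_mul_self_lt, abs_of_pos hδ]; exact htδ) rfl)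
      rw [lt_div_iff₀ (hpos x)] at this
      have e : (f (x + t) - f x) / t - f x = ((f t - 1) / t - 1) * f x := by
        rw [hadd]; field_simp
      rwa [e, abs_mul, abs_of_pos (hpos x)]
  · rintro ⟨f, hf, hQ⟩
    simp only [IsExponentialRel, hQ]
    refine ⟨fun x => ⟨_, rfl⟩, fun x y z h h' => h.trans h'.symm, ?_, ?_, ?_, ?_⟩
    · rintro x x' _ _ rfl rfl; exact (hf.map_add x x').symm
    · rintro x x' _ _ h rfl rfl; exact hf.strictMono h
    · exact fun y => ⟨fun h => (hf.exists_eq h).imp fun _ => Eq.symm, fun ⟨x, h⟩ => h ▸ hf.pos x⟩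
    · intro ε hε
      obtain ⟨δ, hδ, h⟩ := hf.deriv_eq_self 0 ε hε
      refine ⟨δ, hδ, ?_⟩
      rintro t _ ht htδ rfl
      rw [← key ε t _ hε ht]
      rw [← abs_lt_iff_mul_self_lt, abs_of_pos hδ] at htδ
      simpa [hf.map_zero] using h t ht htδ

end OrderedFields

/-! ### Eliminating the parameters of the exponential function -/

section ParameterFreeExponential

variable {L : FirstOrder.Language.{u, v}} {ι : orderedRing →ᴸ L} {T : L.Theory}

/-- Definable exponential functions in models of an o-minimal theory are unique. -/
theorem IsOMinimal.exponential_unique (homin : IsOMinimal ι T) {γ : Type w}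
    (ψ : L.Formula (γ ⊕ Fin 2)) (R : OrderedFieldModel ι T) (w w' : γ → R) {f g : R → R}
    (hf : IsExponential f) (hg : IsExponential g)
    (hfψ : ∀ x y, ψ.Realize (Sum.elim w ![x, y]) ↔ y = f x)
    (hgψ : ∀ x y, ψ.Realize (Sum.elim w' ![x, y]) ↔ y = g x) : f = g := by
  -- This `s` makes `f x = g (s * x)` true at `x = 1`. The definable additive group of all such `x`
  -- is then everything, and comparing derivatives gives `s = 1`.
  obtain ⟨s, hs⟩ := hg.exists_eq (hf.pos 1)
  let K : AddSubgroup R :=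
    { carrier := {x | f x = g (s * x)}
      zero_mem' := by simp [hf.map_zero, hg.map_zero]
      add_mem' := fun {x y} hx hy => by
        simp only [Set.mem_ofPred_eq] at hx hy ⊢
        rw [mul_add, hf.map_add, hg.map_add, hx, hy]
      neg_mem' := fun {x} hx => by
        simp only [Set.mem_ofPred_eq] at hx ⊢
        rw [mul_neg, hf.map_neg, hg.map_neg, hx] }
  have hKiff : ∀ x, x ∈ K ↔ ∃ y, ψ.Realize (Sum.elim w ![x, y]) ∧
      ψ.Realize (Sum.elim w' ![s * x, y]) := by
    intro x
    simp only [hfψ, hgψ]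
    exact ⟨fun h => ⟨_, rfl, h⟩, fun ⟨y, h, h'⟩ => h.symm.trans h'⟩
  have h1 : UniformlyDefinable (ι := ι) (T := T) (fun R (W : γ ⊕ γ → R) v => ∃ y,
      ψ.Realize (Sum.elim (fun c => W (Sum.inl c)) ![v 0, y]) ∧
      ψ.Realize (Sum.elim (fun c => W (Sum.inr c)) ![v 1 * v 0, y])) :=
    .ex (.and (.formula₂_params ψ Sum.inl (.var 1) (.var 0))
      (.formula₂_params ψ Sum.inr (.mul (.var 2) (.var 1)) (.var 0)))
  have h2 : UniformlyDefinable (ι := ι) (T := T) (fun R (W : γ ⊕ γ → R) v =>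
      0 < v 0 ∧ ∀ x, 0 < x → x < v 0 → ∃ y,
        ψ.Realize (Sum.elim (fun c => W (Sum.inl c)) ![x, y]) ∧
        ψ.Realize (Sum.elim (fun c => W (Sum.inr c)) ![v 1 * x, y])) :=
    .and (.lt .zero (.var 0)) (.all (.imp (.lt .zero (.var 0)) (.imp (.lt (.var 0) (.var 1))
      (.ex (.and (.formula₂_params ψ Sum.inl (.var 1) (.var 0))
        (.formula₂_params ψ Sum.inr (.mul (.var 3) (.var 1)) (.var 0)))))))
  have hK : IsFiniteUnionOfIntervals (K : Set R) := by
    have := homin R _ (UniformlyDefinable.definable₁ (P := fun R (W : γ ⊕ γ → R) v x => ∃ y,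
      ψ.Realize (Sum.elim (fun c => W (Sum.inl c)) ![x, y]) ∧
      ψ.Realize (Sum.elim (fun c => W (Sum.inr c)) ![v 0 * x, y])) h1 R (Sum.elim w w')
      (fun _ => s))
    exact (congrArg IsFiniteUnionOfIntervals (Set.ext hKiff)).mpr this
  have hS : IsFiniteUnionOfIntervals {t : R | 0 < t ∧ ∀ x, 0 < x → x < t → x ∈ K} := by
    have := homin R _ (UniformlyDefinable.definable₁ (P := fun R (W : γ ⊕ γ → R) v t =>
      0 < t ∧ ∀ x, 0 < x → x < t → ∃ y,
        ψ.Realize (Sum.elim (fun c => W (Sum.inl c)) ![x, y]) ∧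
        ψ.Realize (Sum.elim (fun c => W (Sum.inr c)) ![v 0 * x, y])) h2 R (Sum.elim w w')
      (fun _ => s))
    simp only [hKiff]
    exact this
  have hscale : ∀ x, f x = g (s * x) := fun x => by
    have : x ∈ K := K.eq_top_of_isFiniteUnionOfIntervals (by simpa [K] using hs.symm) hK hS ▸
      AddSubgroup.mem_top x
    exact this
  have hs1 := hf.eq_one_of_scaling hg hscale
  funext x
  rw [hscale, hs1, one_mul]

theorem uniformlyDefinable_isExponentialRel {γ : Type w} (ψ : L.Formula (γ ⊕ Fin 2)) :
    UniformlyDefinable (ι := ι) (T := T) (fun R (w : γ → R) _ =>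
      IsExponentialRel (fun x y => ψ.Realize (Sum.elim w ![x, y]))) := by
  unfold IsExponentialRel
  have hψ : ∀ j k : ℕ, UniformlyDefinable (ι := ι) (T := T)
      (fun R (w : γ → R) v => ψ.Realize (Sum.elim w ![v j, v k])) :=
    fun j k => .formula₂_params ψ id (.var j) (.var k)
  have hadd : UniformlyDefinable (ι := ι) (T := T) (fun R (w : γ → R) v =>
      ψ.Realize (Sum.elim w ![v 3 + v 2, v 1 * v 0])) :=
    .formula₂_params ψ id (.add (.var 3) (.var 2)) (.mul (.var 1) (.var 0))
  have hdiff : UniformTerm (ι := ι) (T := T) (fun R (_ : γ → R) v => v 0 - 1 - v 1) :=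
    .sub (.sub (.var 0) .one) (.var 1)
  have herr : UniformTerm (ι := ι) (T := T) (fun R (_ : γ → R) v => v 3 * v 1) :=
    .mul (.var 3) (.var 1)
  refine .and (.all (.ex (hψ 1 0))) <|
    .and (.all (.all (.all (.imp (hψ 2 1) (.imp (hψ 2 0) (.eq (.var 1) (.var 0))))))) <|
    .and (.all (.all (.all (.all (.imp (hψ 3 1) (.imp (hψ 2 0) hadd)))))) <|
    .and (.all (.all (.all (.all (.imp (.lt (.var 3) (.var 2)) (.imp (hψ 3 1) (.imp (hψ 2 0)
      (.lt (.var 1) (.var 0))))))))) <|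
    .and (.all (.iff (.lt .zero (.var 0)) (.ex (hψ 0 1)))) <|
    .all (.imp (.lt .zero (.var 0)) (.ex (.and (.lt .zero (.var 0)) (.all (.all
      (.imp (.not (.eq (.var 1) .zero)) (.imp (.lt (.mul (.var 1) (.var 1)) (.mul (.var 2) (.var 2)))
        (.imp (hψ 1 0) (.lt (.mul hdiff hdiff) (.mul herr herr))))))))))

/-- The exponential function that a complete o-minimal theory defines is definable without
parameters, by one formula in all models. -/
theorem exists_definesExponentialFunction (hcomplete : T.IsComplete) (homin : IsOMinimal ι T)
    (hexp : DefinesExponential ι T) : ∃ φ : L.Formula (Fin 2), DefinesExponentialFunction ι T φ := by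
  obtain ⟨R₀, f₀, hf₀, hdef⟩ := hexp
  rw [Set.Definable₂, Set.definable_iff_exists_formula_sum] at hdef
  obtain ⟨ψ, hψ⟩ := hdef
  have hψ₀ : ∀ x y : R₀, ψ.Realize (Sum.elim (↑) ![x, y]) ↔ y = f₀ x := by
    intro x y
    have := Set.ext_iff.1 hψ ![x, y]
    exact this.symm
  obtain ⟨θ, hθ⟩ := uniformlyDefinable_isExponentialRel (ι := ι) (T := T) ψ
  -- All variables are quantified away, including the dummy numbered ones, so `θ'` is a sentence.
  obtain ⟨θ', hθ'⟩ := exists_formula_realize_iff_exists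
    (θ.relabel (Sum.inl : _ → ((↥(Set.univ : Set R₀) ⊕ ℕ) ⊕ Empty)))
  -- All parameters for which `ψ` gives an exponential give the same one, so quantifying them
  -- existentially leaves its graph.
  let χ : L.Formula (↥(Set.univ : Set R₀) ⊕ ℕ) :=
    θ ⊓ ψ.relabel (Sum.map id Fin.val)
  obtain ⟨χ', hχ'⟩ := exists_formula_realize_iff_exists χ
  have hsent : ∀ R : OrderedFieldModel ι T, R ⊨ (θ' : L.Sentence) ↔
      ∃ w : ↥(Set.univ : Set R₀) → R, IsExponentialRel (fun x y => ψ.Realize (Sum.elim w ![x, y])) := by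
    intro R
    refine (hθ' R default).trans ?_
    simp only [Formula.realize_relabel, Sum.elim_comp_inl]
    constructor
    · rintro ⟨W, hW⟩
      refine ⟨W ∘ Sum.inl, (hθ R _ (W ∘ Sum.inr)).1 ?_⟩
      rwa [Sum.elim_comp_inl_inr]
    · rintro ⟨w, hw⟩
      exact ⟨Sum.elim w 0, (hθ R w 0).2 hw⟩
  have hT : T ⊨ᵇ (θ' : L.Sentence) := by
    have := R₀.isModel
    rw [← hcomplete.realize_sentence_iff _ R₀, hsent]
    exact ⟨_, isExponentialRel_iff.2 ⟨f₀, hf₀, hψ₀⟩⟩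
  refine ⟨χ'.relabel (fun k => if k = 0 then 0 else 1), fun R => ?_⟩
  have := R.isModel
  obtain ⟨w, hw⟩ := (hsent R).1 (hT.realize_sentence R)
  obtain ⟨f, hf, hfψ⟩ := isExponentialRel_iff.1 hw
  refine ⟨f, hf, fun x y => ?_⟩
  rw [Formula.realize_relabel, hχ']
  have hχ : ∀ W : ↥(Set.univ : Set R₀) → R,
      χ.Realize (Sum.elim W (![x, y] ∘ fun k => if k = 0 then 0 else 1)) ↔
        IsExponentialRel (fun x y => ψ.Realize (Sum.elim W ![x, y])) ∧
        ψ.Realize (Sum.elim W ![x, y]) := by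
    intro W
    have e : Sum.elim W (![x, y] ∘ fun k : ℕ => if k = 0 then (0 : Fin 2) else 1) ∘
        Sum.map id Fin.val = Sum.elim W ![x, y] := by
      funext s
      rcases s with c | d
      · rfl
      · fin_cases d <;> rfl
    simp only [χ, Formula.realize_inf, hθ, Formula.realize_relabel, e]
  simp only [hχ]
  constructor
  · rintro ⟨W, hW, hxy⟩
    obtain ⟨g, hg, hgψ⟩ := isExponentialRel_iff.1 hW
    rw [homin.exponential_unique ψ R w W hf hg hfψ hgψ]
    exact (hgψ x y).1 hxy
  · rintro hy
    exact ⟨w, hw, (hfψ x y).2 hy⟩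

end ParameterFreeExponential

/-! ### Supports of finite sums of monomials -/

section MonomialSupports

variable {R : Type*} [Field R] [LinearOrder R] [IsStrictOrderedRing R]

/-- `O` is a proper convex subring closed under the function `E`, and `M` is a monomial group whose
elements above `1` are mapped to `M` by `E`. -/
structure IsExpMonomialGroup (O M : Set R) (E : R → R) : Prop where
  zero_mem : 0 ∈ O
  one_mem : 1 ∈ O
  neg_mem : ∀ x, x ∈ O → -x ∈ O
  add_mem : ∀ x y, x ∈ O → y ∈ O → x + y ∈ O
  mul_mem : ∀ x y, x ∈ O → y ∈ O → x * y ∈ O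
  convex : ∀ x y z, x ∈ O → z ∈ O → x < y → y < z → y ∈ O
  proper : ∃ x, x ∉ O
  exp_mem : ∀ x, x ∈ O → E x ∈ O
  pos : ∀ m, m ∈ M → 0 < m
  one_mem_group : 1 ∈ M
  mul_mem_group : ∀ m n, m ∈ M → n ∈ M → m * n ∈ M
  inv_mem_group : ∀ m n, m ∈ M → m * n = 1 → n ∈ M
  eq_one : ∀ m x, m ∈ M → m ∈ O → x ∈ O → m * x = 1 → m = 1
  exists_eq_mul : ∀ x, x ≠ 0 → ∃ m u, m ∈ M ∧ u ∈ O ∧ x = m * u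
  exp_mem_group : ∀ m, m ∈ M → 1 < m → E m ∈ M

/-- The infinitesimals of a convex subring. -/
def IsSmall (O : Set R) (x : R) : Prop := ∀ u ∈ O, x * u < 1

/-- The monomial `y` is in the support of `b`: the quotient `b / y` is not the sum of the logarithm
of a monomial and an infinitesimal. -/
def InSupport (O M : Set R) (E : R → R) (y b : R) : Prop :=
  y ∈ M ∧ ¬ ∃ l x, E l ∈ M ∧ IsSmall O x ∧ b = y * (l + x)

namespace IsExpMonomialGroup

variable {O M : Set R} {E : R → R}

theorem mem_of_pos_of_le (h : IsExpMonomialGroup O M E) {x y : R} (hy : y ∈ O) (hx : 0 < x)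
    (hxy : x ≤ y) : x ∈ O := by
  rcases hxy.eq_or_lt with rfl | hlt
  · exact hy
  · exact h.convex _ _ _ h.zero_mem hy hx hlt

theorem isSmall_add (h : IsExpMonomialGroup O M E) {x y : R} (hx : IsSmall O x)
    (hy : IsSmall O y) : IsSmall O (x + y) := by
  intro u hu
  have h1 := hx _ (h.add_mem u u hu hu)
  have h2 := hy _ (h.add_mem u u hu hu)
  linarith

/-- The one-sided bound in `IsSmall` is symmetric because `O` is closed under negation. -/
theorem isSmall_neg (h : IsExpMonomialGroup O M E) {x : R} (hx : IsSmall O x) :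
    IsSmall O (-x) := by
  intro u hu
  simpa using hx _ (h.neg_mem u hu)

/-- If `m * u ≥ 1` with `u ∈ O`, then `m⁻¹ ≤ u` puts `m⁻¹` in `O`, so `m` is a monomial unit and
equals `1`. -/
theorem isSmall_of_lt_one (h : IsExpMonomialGroup O M E) {m : R} (hm : m ∈ M) (hm1 : m < 1) :
    IsSmall O m := by
  intro u hu
  by_contra! hle
  have hpos := h.pos m hm
  have hinv : m⁻¹ ∈ O := h.mem_of_pos_of_le hu (inv_pos.2 hpos) ((inv_le_iff_one_le_mul₀' hpos).2 hle)
  exact hm1.ne (h.eq_one m _ hm (h.mem_of_pos_of_le h.one_mem hpos hm1.le) hinv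
    (mul_inv_cancel₀ hpos.ne'))

/-- Closure of `O` under `E` makes both `E l` and its inverse `E (-l)` elements of `O`, so the
monomial `E l` is a unit. -/
theorem log_eq_zero (h : IsExpMonomialGroup O M E) (hE : IsExponential E) {l : R} (hl : E l ∈ M)
    (hlO : l ∈ O) : l = 0 := by
  have h1 := h.eq_one (E l) (E (-l)) hl (h.exp_mem _ hlO) (h.exp_mem _ (h.neg_mem _ hlO))
    (by rw [hE.map_neg, mul_inv_cancel₀ (hE.pos l).ne'])
  exact hE.strictMono.injective (h1.trans hE.map_zero.symm)

theorem exp_add_mem (h : IsExpMonomialGroup O M E) (hE : IsExponential E) {k l : R}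
    (hk : E k ∈ M) (hl : E l ∈ M) : E (k + l) ∈ M := by
  rw [hE.map_add]
  exact h.mul_mem_group _ _ hk hl

theorem exp_neg_mem (h : IsExpMonomialGroup O M E) (hE : IsExponential E) {l : R}
    (hl : E l ∈ M) : E (-l) ∈ M := by
  refine h.inv_mem_group _ _ hl ?_
  rw [hE.map_neg, mul_inv_cancel₀ (hE.pos l).ne']

/-- Each quotient `m / y` is a monomial other than `1`: those above `1` are logarithms of monomials,
those below are infinitesimal, and both kinds are closed under addition. -/
theorem exists_log_add_small_of_not_mem (h : IsExpMonomialGroup O M E) (hE : IsExponential E)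
    {y : R} (hy : y ∈ M) (F : Finset R) (hF : ∀ m ∈ F, m ∈ M) (hyF : y ∉ F) :
    ∃ l x, E l ∈ M ∧ IsSmall O x ∧ ∑ m ∈ F, m = y * (l + x) := by
  induction F using Finset.induction_on with
  | empty =>
    refine ⟨0, 0, ?_, fun u _ => by simp, by simp⟩
    rw [hE.map_zero]; exact h.one_mem_group
  | insert m F hmF ih =>
    obtain ⟨l, x, hl, hx, hsum⟩ := ih (fun m hm => hF m (Finset.mem_insert_of_mem hm))
      (fun hh => hyF (Finset.mem_insert_of_mem hh))
    have hy0 := h.pos y hy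
    have hq : m * y⁻¹ ∈ M := h.mul_mem_group _ _ (hF m (Finset.mem_insert_self _ _))
      (h.inv_mem_group y _ hy (mul_inv_cancel₀ hy0.ne'))
    have hmul : y * (m * y⁻¹) = m := by field_simp
    rw [Finset.sum_insert hmF, hsum]
    rcases lt_trichotomy (m * y⁻¹) 1 with hlt | heq | hgt
    · refine ⟨l, m * y⁻¹ + x, hl, h.isSmall_add (h.isSmall_of_lt_one hq hlt) hx, ?_⟩
      rw [mul_add, mul_add, mul_add, hmul]; ring
    · rw [heq, mul_one] at hmul
      exact absurd (hmul ▸ Finset.mem_insert_self _ _) hyF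
    · refine ⟨m * y⁻¹ + l, x, h.exp_add_mem hE (h.exp_mem_group _ hq hgt) hl, hx, ?_⟩
      rw [mul_add, mul_add, mul_add, hmul]; ring

/-- The support of a finite sum of distinct monomials. -/
theorem inSupport_sum_iff (h : IsExpMonomialGroup O M E) (hE : IsExponential E) (F : Finset R)
    (hF : ∀ m ∈ F, m ∈ M) (y : R) : InSupport O M E y (∑ m ∈ F, m) ↔ y ∈ F := by
  constructor
  · rintro ⟨hy, hne⟩
    by_contra hyF
    exact hne (h.exists_log_add_small_of_not_mem hE hy F hF hyF)
  · intro hyF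
    refine ⟨hF y hyF, ?_⟩
    rintro ⟨l', x', hl', hx', hsum'⟩
    obtain ⟨l, x, hl, hx, hsum⟩ := h.exists_log_add_small_of_not_mem hE (hF y hyF) (F.erase y)
      (fun m hm => hF m (Finset.mem_of_mem_erase hm)) (Finset.notMem_erase y F)
    rw [← Finset.add_sum_erase F _ hyF, hsum] at hsum'
    have hy0 := h.pos y (hF y hyF)
    have heq : 1 + (l + x) = l' + x' := by
      apply mul_left_cancel₀ hy0.ne'
      rw [← hsum']; ring
    have hd : IsSmall O (x + -x') := h.isSmall_add hx (h.isSmall_neg hx')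
    have hd' := h.isSmall_neg hd
    have h1 := hd 1 h.one_mem
    have h2 := hd' 1 h.one_mem
    have hz : l' + -l = 1 + (x + -x') := by linarith
    -- The difference of logarithms is `1` plus an infinitesimal, hence between `0` and `2`. So it
    -- lies in `O` and vanishes, which would make `-1` infinitesimal.
    have hlO : l' + -l ∈ O := by
      rw [hz]
      exact h.convex 0 _ (1 + 1) h.zero_mem (h.add_mem _ _ h.one_mem h.one_mem)
        (by linarith) (by linarith)
    have := h.log_eq_zero hE (h.exp_add_mem hE hl' (h.exp_neg_mem hE hl)) hlO
    linarith

/-- The monomial part of an element outside `O` exceeds `1`; otherwise it would lie in `O`, and so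
would its product with the unit part. -/
theorem exists_one_lt (h : IsExpMonomialGroup O M E) : ∃ m ∈ M, 1 < m := by
  obtain ⟨x, hx⟩ := h.proper
  obtain ⟨m, u, hm, hu, rfl⟩ := h.exists_eq_mul x (fun hx0 => hx (hx0 ▸ h.zero_mem))
  refine ⟨m, hm, ?_⟩
  by_contra! hle
  exact hx (h.mul_mem _ _ (h.mem_of_pos_of_le h.one_mem (h.pos m hm) hle) hu)

theorem exists_injective_forall_finset_inSupport (h : IsExpMonomialGroup O M E)
    (hE : IsExponential E) : ∃ e : List Bool → R, Function.Injective e ∧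
      ∀ F : Finset (List Bool), ∃ b, ∀ y, InSupport O M E y b ↔ ∃ i ∈ F, y = e i := by
  obtain ⟨m, hm, hm1⟩ := h.exists_one_lt
  have hpow : ∀ k : ℕ, m ^ k ∈ M := by
    intro k
    induction k with
    | zero => simpa using h.one_mem_group
    | succ k ih => rw [pow_succ]; exact h.mul_mem_group _ _ ih hm
  refine ⟨fun i => m ^ Encodable.encode i,
    (pow_right_injective₀ (by linarith) hm1.ne').comp Encodable.encode_injective, fun F => ?_⟩
  refine ⟨∑ x ∈ F.image (fun i => m ^ Encodable.encode i), x, fun y => ?_⟩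
  rw [h.inSupport_sum_iff hE _ (by simp [hpow])]
  simp [eq_comm]

end IsExpMonomialGroup

end MonomialSupports

/-! ### Reading the axioms in a model and defining supports -/

section ModelsOfTheoryTM

variable {L : FirstOrder.Language.{u, v}} {ι : orderedRing →ᴸ L} {T : L.Theory}

/-- The reduct to `L` of a model of `T_𝔐`. -/
def OrderedFieldModel.reduct {T' : (LM L).Theory} (N : OrderedFieldModel (extLM ι) T')
    (hT : N ⊨ (LHom.sumInl : L →ᴸ LM L).onTheory T) : OrderedFieldModel ι T :=
  letI : L.Structure N := (LHom.sumInl : L →ᴸ LM L).reduct N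
  { Carrier := N
    struc := (LHom.sumInl : L →ᴸ LM L).reduct N
    compatible := ⟨N.compatible.zero, N.compatible.one, N.compatible.neg, N.compatible.add,
      N.compatible.mul, N.compatible.lt⟩
    isModel := (LHom.onTheory_model _ T).1 hT }

theorem realize_onFormula_reduct {L' : FirstOrder.Language} (i : L →ᴸ L') {M α : Type*}
    [L'.Structure M] (φ : L.Formula α) (v : α → M) :
    (i.onFormula φ).Realize v ↔ @Formula.Realize L M (i.reduct M) _ φ v :=
  let _ : L.Structure M := i.reduct M
  i.realize_onFormula φ

theorem exists_orderedFieldModel (hrcf : ExtendsRCF ι T) {T' : (LM L).Theory}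
    (hT' : ∀ σ ∈ theoryTM ι T, T' ⊨ᵇ σ) (N : T'.ModelType.{u, v, max u v}) :
    ∃ (_ : Field N) (_ : LinearOrder N) (_ : IsStrictOrderedRing N),
      CompatibleOrderedField (extLM ι) N := by
  let _ : L.Structure N := (LHom.sumInl : L →ᴸ LM L).reduct N
  have hN : N ⊨ T := by
    rw [← LHom.onTheory_model (LHom.sumInl : L →ᴸ LM L), Theory.model_iff]
    exact fun σ hσ => (hT' σ (Or.inl (Or.inl (Or.inl (Or.inl hσ))))).realize_sentence N
  obtain ⟨i₁, i₂, i₃, -, h⟩ := hrcf (Theory.ModelType.of T N)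
  let _ : Field N := i₁
  let _ : LinearOrder N := i₂
  exact ⟨i₁, i₂, i₃, h.zero, h.one, h.neg, h.add, h.mul, h.lt⟩

section Realize

variable {T' : (LM L).Theory} (N : OrderedFieldModel (extLM ι) T') {k : ℕ} {e : Empty → N}
  {xs : Fin k → N}

theorem realize_inO {t : (LM L).Term (Empty ⊕ Fin k)} : (inO t).Realize e xs ↔
    Structure.RelMap (symO : (LM L).Relations 1) ![t.realize (Sum.elim e xs)] :=
  BoundedFormula.realize_rel₁

theorem realize_inM {t : (LM L).Term (Empty ⊕ Fin k)} : (inM t).Realize e xs ↔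
    Structure.RelMap (symM : (LM L).Relations 1) ![t.realize (Sum.elim e xs)] :=
  BoundedFormula.realize_rel₁

theorem realize_ltF {s t : (LM L).Term (Empty ⊕ Fin k)} : (ltF (extLM ι) s t).Realize e xs ↔
    s.realize (Sum.elim e xs) < t.realize (Sum.elim e xs) := by
  rw [ltF, BoundedFormula.realize_rel₂, N.compatible.lt]

theorem realize_zeroT {z : Empty ⊕ Fin k → N} :
    (zeroT (extLM ι) : (LM L).Term (Empty ⊕ Fin k)).realize z = 0 :=
  Term.realize_constants.trans (funMap_eq_coe_constants.symm.trans N.compatible.zero)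

theorem realize_oneT {z : Empty ⊕ Fin k → N} :
    (oneT (extLM ι) : (LM L).Term (Empty ⊕ Fin k)).realize z = 1 :=
  Term.realize_constants.trans (funMap_eq_coe_constants.symm.trans N.compatible.one)

theorem realize_negT {z : Empty ⊕ Fin k → N} {t : (LM L).Term (Empty ⊕ Fin k)} :
    (negT (extLM ι) t).realize z = -t.realize z := by
  rw [negT, Term.realize_functions_apply₁, N.compatible.neg]

theorem realize_addT {z : Empty ⊕ Fin k → N} {s t : (LM L).Term (Empty ⊕ Fin k)} :
    (addT (extLM ι) s t).realize z = s.realize z + t.realize z := by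
  rw [addT, Term.realize_functions_apply₂, N.compatible.add]

theorem realize_mulT {z : Empty ⊕ Fin k → N} {s t : (LM L).Term (Empty ⊕ Fin k)} :
    (mulT (extLM ι) s t).realize z = s.realize z * t.realize z := by
  rw [mulT, Term.realize_functions_apply₂, N.compatible.mul]

theorem realize_liftF {φ : L.Formula (Fin 2)} {xs : Fin 2 → N} :
    (liftF φ).Realize e xs ↔ ((LHom.sumInl : L →ᴸ LM L).onFormula φ).Realize xs :=
  Formula.realize_relabel_sumInr _

end Realize

theorem isExpMonomialGroup_of_model {T' : (LM L).Theory} (N : OrderedFieldModel (extLM ι) T')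
    (hN : N ⊨ theoryTM ι T) {φ : L.Formula (Fin 2)} (hφ : DefinesExponentialFunction ι T φ) :
    ∃ E : N → N, IsExponential E ∧
      (∀ x y : N, ((LHom.sumInl : L →ᴸ LM L).onFormula φ).Realize ![x, y] ↔ y = E x) ∧
      IsExpMonomialGroup {x : N | Structure.RelMap (symO : (LM L).Relations 1) ![x]}
        {x : N | Structure.RelMap (symM : (LM L).Relations 1) ![x]} E := by
  rw [Theory.model_iff] at hN
  have hT : N ⊨ (LHom.sumInl : L →ᴸ LM L).onTheory T :=
    (Theory.model_iff _).2 fun σ hσ => hN σ (Or.inl (Or.inl (Or.inl (Or.inl hσ))))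
  have hO : ∀ σ ∈ properConvexSubringAxioms (extLM ι), N ⊨ σ := fun σ hσ =>
    hN σ (Or.inl (Or.inl (Or.inl (Or.inr hσ))))
  have hM : ∀ σ ∈ monomialGroupAxioms (extLM ι), N ⊨ σ := fun σ hσ =>
    hN σ (Or.inl (Or.inr hσ))
  obtain ⟨E, hE, hEφ⟩ := hφ (N.reduct hT)
  have hE' : ∀ x y : N, ((LHom.sumInl : L →ᴸ LM L).onFormula φ).Realize ![x, y] ↔ y = E x := by
    intro x y
    exact (realize_onFormula_reduct _ φ _).trans (hEφ x y)
  -- The `T`-convexity axiom for the continuous function `exp`.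
  have hexpO := hN _ (Or.inl (Or.inl (Or.inr ⟨φ, fun R => by
    obtain ⟨f, hf, hfφ⟩ := hφ R
    exact ⟨f, hf.isContinuous, hfφ⟩, rfl⟩)))
  have hexpM := hN _ (Or.inr ⟨φ, hφ, rfl⟩)
  simp only [properConvexSubringAxioms, Set.mem_insert_iff, Set.mem_singleton_iff, forall_eq_or_imp,
    forall_eq] at hO
  simp only [monomialGroupAxioms, Set.mem_insert_iff, Set.mem_singleton_iff, forall_eq_or_imp,
    forall_eq] at hM
  have hsnoc : ∀ xs : Fin 2 → N, xs = ![xs 0, xs 1] := fun xs => by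
    funext i; fin_cases i <;> rfl
  have hlift : ∀ (xs : Fin 2 → N) (e : Empty → N), (liftF φ).Realize e xs ↔ xs 1 = E (xs 0) := by
    intro xs e
    rw [realize_liftF, hsnoc xs, hE']
    rfl
  simp [Sentence.Realize, Formula.Realize, realize_inO, realize_inM, realize_ltF, realize_zeroT,
    realize_oneT, realize_negT, realize_addT, realize_mulT, Fin.snoc] at hO hM
  simp [Sentence.Realize, Formula.Realize, realize_inO, realize_inM, realize_ltF,
    realize_oneT, hlift, Fin.snoc] at hexpO hexpM
  obtain ⟨h0, h1, hneg, hadd, hmul, hconv, hprop⟩ := hO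
  obtain ⟨hpos, hM1, hMmul, hMinv, hMeq, hMex⟩ := hM
  refine ⟨E, hE, hE', ⟨h0, h1, hneg, hadd, hmul, hconv, hprop, fun x hx => hexpO x _ hx rfl, hpos,
    hM1, hMmul, hMinv, hMeq, fun x hx => ?_, fun m hm hm1 => (hexpM m _ hm hm1 rfl).1⟩⟩
  obtain ⟨m, a, ⟨_, ⟨⟨hm, ha⟩, _⟩, _⟩, hxa⟩ := hMex x hx
  exact ⟨m, a, hm, ha, hxa⟩

/-- This is `InSupport` with `E l ∈ M` unfolded through the graph formula; variable `0` is the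
monomial and variable `1` the sum. -/
theorem uniformlyDefinable_inSupport {T' : (LM L).Theory} (φ : L.Formula (Fin 2)) :
    UniformlyDefinable (ι := extLM ι) (T := T') (fun N (_ : Empty → N) v =>
      Structure.RelMap (symM : (LM L).Relations 1) ![v 0] ∧
        ¬ ∃ l x, (∃ m, ((LHom.sumInl : L →ᴸ LM L).onFormula φ).Realize ![l, m] ∧
            Structure.RelMap (symM : (LM L).Relations 1) ![m]) ∧
          (∀ u, Structure.RelMap (symO : (LM L).Relations 1) ![u] → x * u < 1) ∧
          v 1 = v 0 * (l + x)) :=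
  .and (.rel₁ _ (.var 0)) <| .not <| .ex <| .ex <|
    .and (.ex (.and (.formula₂ _ (.var 2) (.var 0)) (.rel₁ _ (.var 0)))) <|
    .and (.all (.imp (.rel₁ _ (.var 0)) (.lt (.mul (.var 1) (.var 0)) .one)))
      (.eq (.var 3) (.mul (.var 2) (.add (.var 1) (.var 0))))

end ModelsOfTheoryTM

theorem corollary5p4 {L : FirstOrder.Language.{u, v}} (ι : orderedRing →ᴸ L) (T : L.Theory)
    (hcomplete : T.IsComplete) (hrcf : ExtendsRCF ι T) (homin : IsOMinimal ι T)
    (hexp : DefinesExponential ι T)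
    (T' : (LM L).Theory) (hT' : IsCompletionOf T' (theoryTM ι T)) :
    HasATP T' := by
  obtain ⟨φ, hφ⟩ := exists_definesExponentialFunction hcomplete homin hexp
  obtain ⟨N₀⟩ := hT'.1.1
  obtain ⟨i₁, i₂, i₃, hcomp⟩ := exists_orderedFieldModel hrcf hT'.2 N₀
  let N : OrderedFieldModel (extLM ι) T' :=
    { Carrier := N₀, compatible := hcomp, isModel := N₀.is_model }
  have hN : N ⊨ theoryTM ι T :=
    (Theory.model_iff _).2 fun σ hσ => (hT'.2 σ hσ).realize_sentence N₀
  obtain ⟨E, hE, hEφ, hgroup⟩ := isExpMonomialGroup_of_model N hN hφ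
  obtain ⟨e, he, hfin⟩ := hgroup.exists_injective_forall_finset_inSupport hE
  obtain ⟨σ, hσ⟩ := uniformlyDefinable_inSupport (ι := ι) (T' := T') φ
  refine hasATP_of_forall_finset_definable N₀
    -- Only variables `0` and `1` matter; all later ones are merged with `1`.
    (σ.relabel (Sum.elim Empty.elim fun k => if k = 0 then 0 else 1)) e he fun F => ?_
  obtain ⟨b, hb⟩ := hfin F
  refine ⟨b, fun y => ?_⟩
  rw [← hb, Formula.realize_relabel]
  have hv : ![y, b] ∘ (Sum.elim Empty.elim fun k : ℕ => if k = 0 then (0 : Fin 2) else 1) =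
      Sum.elim Empty.elim (fun k : ℕ => ![y, b] (if k = 0 then 0 else 1)) := by
    funext s
    rcases s with s | k
    · exact s.elim
    · rfl
  rw [hv]
  refine (hσ N Empty.elim _).trans (and_congr_right fun _ => not_congr ?_)
  simp only [hEφ, exists_eq_left]
  rfl
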